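/- Let $\mathcal V_1,\mathcal V_2$ be finite-dimensional real normed spaces, and let $\mathcal V=\mathcal V_1\times\mathcal V_2$ carry the norm $\|x\|^2=\|x_1\|^2+\|x_2\|^2$ and its dual $\mathcal V^*$ the dual norm $\|\cdot\|_*$. Let $\mathcal X_i\subset\mathcal V_i$ ($i=1,2$) be compact and convex, $\mathcal X=\mathcal X_1\times\mathcal X_2$, and let $f:\mathcal X\to\mathbb R$ be of class $C^1$ with gradient field $g(x)=(\nabla_{x_1}f(x),-\nabla_{x_2}f(x))\in\mathcal V^*$. Suppose that $f$ is strictly convex-concave: $f(\cdot,x_2)$ is strictly convex on $\mathcal X_1$ for every $x_2\in\mathcal X_2$ and $f(x_1,\cdot)$ is strictly concave on $\mathcal X_2$ for every $x_1\in\mathcal X_1$. Let $h:\mathcal X\to\mathbb R$ be continuous and $K$-strongly convex for some $K>0$, i.e. $h(tx+(1-t)x')\le t\,h(x)+(1-t)h(x')-\tfrac K2 t(1-t)\|x-x'\|^2$ for all $x,x'\in\mathcal X$, $t\in[0,1]$. For $x\in\mathcal X$ let $\partial h(x)=\{y\in\mathcal V^*: h(x')\ge h(x)+\langle y,x'-x\rangle\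 \forall x'\in\mathcal X\}$, let $\operatorname{dom}\partial h=\{x\in\mathcal X:\partial h(x)\neq\varnothing\}$, and let $\nabla h:\operatorname{dom}\partial h\to\mathcal V^*$ be a continuous selection of $\partial h$. Put $D(p,x)=h(p)-h(x)-\langle\nabla h(x),p-x\rangle$ for $p\in\mathcal X$, $x\in\operatorname{dom}\partial h$, assume Bregman reciprocity ($D(p,x_n)\to0$ whenever $x_n\in\operatorname{dom}\partial h$ converges to $p\in\mathcal X$), and let $P_x(y)=\arg\min_{x'\in\mathcal X}\{\langle y,x-x'\rangle+D(x',x)\}$. Let $(X_n)_{n\ge 1}$ be generated by stochastic mirror descent, $$X_{n+1}=P_{X_n}(-\gamma_n\hat g_n),\qquad X_1\in\operatorname{dom}\partial h,$$ where $X_1$ is a possibly random initial point, the step-sizes $\gamma_n>0$ satisfy $\sum_n\gamma_n=\infty$ and $\sum_n\gamma_n^2<\infty$, and the square-integrable random vectors $\hat g_n\in\mathcal V^*$ satisfy, almost surely for every $n$ and for some constant $G$, $$\mathbb E[\hat g_n\mid\mathcal F_n]=g(X_n),\qquad \mathbb E[\|\hat g_n\|_*^2\mid\mathcal F_n]\le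 G^2,\qquad \mathcal F_n=\sigma(X_1,\dots,X_n).$$ Then $f$ has exactly one saddle point over $\mathcal X$, that is, exactly one $x^*\in\mathcal X$ with $f(x_1^*,x_2)\le f(x_1^*,x_2^*)\le f(x_1,x_2^*)$ for all $x_1\in\mathcal X_1$, $x_2\in\mathcal X_2$, and $X_n\to x^*$ almost surely. -/

import Mathlib

open MeasureTheory Filter Topology

section SaddlePointProblem

variable {E F : Type*} [NormedAddCommGroup E] [NormedSpace ℝ E]
  [NormedAddCommGroup F] [NormedSpace ℝ F]

/-- The feasible region `X = X₁ × X₂`, inside the ambient space `V = E × F` with the product norm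
`‖x‖² = ‖x₁‖² + ‖x₂‖²`. -/
def feasibleSet (X₁ : Set E) (X₂ : Set F) : Set (WithLp 2 (E × F)) :=
  {x | x.fst ∈ X₁ ∧ x.snd ∈ X₂}

/-- `x` is a saddle point of `f` over `X₁ × X₂` (`x₁` minimizes, `x₂` maximizes):
`f (x₁, y₂) ≤ f (x₁, x₂) ≤ f (y₁, x₂)` for all `y₁ ∈ X₁`, `y₂ ∈ X₂`. -/
def IsSaddle (X₁ : Set E) (X₂ : Set F) (f : E → F → ℝ) (x : WithLp 2 (E × F)) : Prop :=
  x ∈ feasibleSet X₁ X₂ ∧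
    (∀ y₂ ∈ X₂, f x.fst y₂ ≤ f x.fst x.snd) ∧ (∀ y₁ ∈ X₁, f x.fst x.snd ≤ f y₁ x.snd)

/-- `f` is strictly convex in its first argument and strictly concave in its second one. -/
def StrictlyConvexConcaveOn (X₁ : Set E) (X₂ : Set F) (f : E → F → ℝ) : Prop :=
  (∀ x₂ ∈ X₂, StrictConvexOn ℝ X₁ (fun x₁ => f x₁ x₂)) ∧
    (∀ x₁ ∈ X₁, StrictConcaveOn ℝ X₂ (fun x₂ => f x₁ x₂))

/-- `f` is of class `C¹` on `X₁ × X₂` with partial gradients `D₁ = ∇_{x₁} f` and `D₂ = ∇_{x₂} f`: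
these are continuous and give the Fréchet derivative of `f` relative to `X₁ × X₂`.
(The derivative is carried as data because it need not be unique when the region has empty
interior, as for a simplex.) -/
structure HasC1GradientOn (X₁ : Set E) (X₂ : Set F) (f : E → F → ℝ)
    (D₁ : WithLp 2 (E × F) → StrongDual ℝ E) (D₂ : WithLp 2 (E × F) → StrongDual ℝ F) : Prop where
  continuousOn_fst : ContinuousOn D₁ (feasibleSet X₁ X₂)
  continuousOn_snd : ContinuousOn D₂ (feasibleSet X₁ X₂)
  hasFDerivWithinAt : ∀ x ∈ feasibleSet X₁ X₂,
    HasFDerivWithinAt (fun y : WithLp 2 (E × F) => f y.fst y.snd)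
      ((D₁ x).comp (WithLp.fstL 2 ℝ E F) + (D₂ x).comp (WithLp.sndL 2 ℝ E F))
      (feasibleSet X₁ X₂) x

/-- The gradient field `g(x) = (∇_{x₁} f(x), -∇_{x₂} f(x))` of the two players, an element of the
dual of the ambient space. -/
noncomputable def gradientField
    (D₁ : WithLp 2 (E × F) → StrongDual ℝ E) (D₂ : WithLp 2 (E × F) → StrongDual ℝ F)
    (x : WithLp 2 (E × F)) : StrongDual ℝ (WithLp 2 (E × F)) :=
  (D₁ x).comp (WithLp.fstL 2 ℝ E F) - (D₂ x).comp (WithLp.sndL 2 ℝ E F)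

end SaddlePointProblem

section MirrorDescent

variable {V : Type*} [NormedAddCommGroup V] [NormedSpace ℝ V]

/-- The subdifferential `∂h(x)` of `h : X → ℝ` (extended by `+∞` outside `X`) at `x ∈ X`. -/
def subdiff (X : Set V) (h : V → ℝ) (x : V) : Set (StrongDual ℝ V) :=
  {y | ∀ x' ∈ X, h x + y (x' - x) ≤ h x'}

/-- The domain `dom ∂h = {x ∈ X : ∂h(x) ≠ ∅}` of the subdifferential. -/
def domSubdiff (X : Set V) (h : V → ℝ) : Set V :=
  {x | x ∈ X ∧ (subdiff X h x).Nonempty}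

/-- The Bregman divergence `D(p, x) = h(p) - h(x) - ⟨∇h(x), p - x⟩`. -/
def bregman (h : V → ℝ) (dh : V → StrongDual ℝ V) (p x : V) : ℝ :=
  h p - h x - dh x (p - x)

/-- `h` is a distance-generating function on `X` with strong convexity modulus `K`, and `dh` is a
continuous selection of its subdifferential, satisfying Bregman reciprocity:
`D(p, xₙ) → 0` whenever `xₙ → p`. -/
structure IsDGF (X : Set V) (K : ℝ) (h : V → ℝ) (dh : V → StrongDual ℝ V) : Prop where
  pos : 0 < K
  continuousOn : ContinuousOn h X
  strongConvexOn : StrongConvexOn X K h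
  selection : ∀ x ∈ domSubdiff X h, dh x ∈ subdiff X h x
  continuousOn_selection : ContinuousOn dh (domSubdiff X h)
  reciprocity : ∀ p ∈ X, ∀ x : ℕ → V, (∀ n, x n ∈ domSubdiff X h) →
    Tendsto x atTop (𝓝 p) → Tendsto (fun n => bregman h dh p (x n)) atTop (𝓝 0)

/-- `x⁺ = P_x(y)`, i.e. `x⁺` attains `min {⟨y, x - x'⟩ + D(x', x) : x' ∈ X}`. -/
def IsProx (X : Set V) (h : V → ℝ) (dh : V → StrongDual ℝ V) (x : V) (y : StrongDual ℝ V)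
    (xplus : V) : Prop :=
  xplus ∈ X ∧ IsMinOn (fun x' => y (x - x') + bregman h dh x' x) X xplus

variable {Ω : Type*} [MeasurableSpace Ω]

/-- The history (natural filtration) of a process: `ℱₙ` is generated by `X₀, …, Xₙ`. -/
@[reducible]
def history (Xs : ℕ → Ω → V) (n : ℕ) : MeasurableSpace Ω :=
  ⨆ k ≤ n, (borel V).comap (Xs k)

/-- `Xs` is a run of mirror descent `Xₙ₊₁ = P_{Xₙ}(-γₙ ĝₙ)`, initialized in `dom ∂h`, with
step-sizes `γ` and gradient inputs `gh`. -/
structure IsMirrorDescent (μ : Measure Ω) (X : Set V) (h : V → ℝ) (dh : V → StrongDual ℝ V)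
    (γ : ℕ → ℝ) (gh : ℕ → Ω → StrongDual ℝ V) (Xs : ℕ → Ω → V) : Prop where
  stronglyMeasurable : ∀ n, StronglyMeasurable (Xs n)
  init : ∀ᵐ ω ∂μ, Xs 0 ω ∈ domSubdiff X h
  step : ∀ n, ∀ᵐ ω ∂μ, IsProx X h dh (Xs n ω) (-(γ n • gh n ω)) (Xs (n + 1) ω)

/-- The gradient inputs `gh` come from a stochastic oracle for the vector field `g` along `Xs`:
`E[ĝₙ | ℱₙ] = g(Xₙ)` and `E[‖ĝₙ‖² | ℱₙ] ≤ G²` almost surely, with `‖·‖` the dual norm.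
Square-integrability makes these conditional expectations meaningful. -/
structure IsStochasticOracle (μ : Measure Ω) (g : V → StrongDual ℝ V) (G : ℝ)
    (gh : ℕ → Ω → StrongDual ℝ V) (Xs : ℕ → Ω → V) : Prop where
  memLp : ∀ n, MemLp (gh n) 2 μ
  unbiased : ∀ n, μ[gh n | history Xs n] =ᵐ[μ] fun ω => g (Xs n ω)
  meanSquare : ∀ n, ∀ᵐ ω ∂μ, (μ[fun ω' => ‖gh n ω'‖ ^ 2 | history Xs n]) ω ≤ G ^ 2

end MirrorDescent

/-! By strict convexity-concavity, a saddle point `x*` (which exists by Sion's minimax theorem)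
satisfies `f(x*₁, x₂) < f(x₁, x*₂)` for every other feasible `x`. The gradient inequality in each
variable turns this into the strict variational inequality `⟨g(x), x - x*⟩ > 0`
(`HasC1GradientOn.gap_le_gradientField`).

The divergence `D(x*, Xₙ)` is then a stochastic Lyapunov function. One step raises it by at most
`-γₙ⟨ĝₙ, Xₙ - x*⟩ + γₙ²‖ĝₙ‖²/(2K)`, whose conditional mean is at most `-γₙ⟨g(Xₙ), Xₙ - x*⟩ +
γₙ²G²/(2K)`. By the Robbins–Siegmund lemma, almost surely `D(x*, Xₙ)` converges and the sum of
`γₙ⟨g(Xₙ), Xₙ - x*⟩` is finite. As the step-sizes are not summable, the gap tends to `0` along a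
subsequence; compactness and strictness give a further subsequence converging to `x*`. Bregman
reciprocity makes the limit of the divergence `0`, and strong convexity makes the whole sequence
converge.

The delicate point is the one-step bound. Optimality of the prox step only says that `∇h(Xₙ) - γₙĝₙ`
is some subgradient at `Xₙ₊₁`, while `D` uses the selected one. Continuity of the selection and
density of the relative interior show that `∇h(x)` has the largest pairing with `p - x` among all
subgradients (`IsDGF.selection_apply_ge`), so replacing one by the other can only lower the
divergence. -/

/-- A continuous convex function has a subgradient at every interior point of its domain. -/
theorem ConvexOn.exists_subgradient_of_mem_interior {W : Type*} [NormedAddCommGroup W]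
    [NormedSpace ℝ W] {U : Set W} {φ : W → ℝ} (hφ : ConvexOn ℝ U φ) (hc : ContinuousOn φ U)
    {w : W} (hw : w ∈ interior U) :
    ∃ y : StrongDual ℝ W, ∀ u ∈ U, φ w + y (u - w) ≤ φ u := by
  have hconv : Convex ℝ {q : W × ℝ | q.1 ∈ interior U ∧ φ q.1 < q.2} :=
    (hφ.subset interior_subset hφ.1.interior).convex_strict_epigraph
  have hopen : IsOpen {q : W × ℝ | q.1 ∈ interior U ∧ φ q.1 < q.2} := by
    have hcont : ContinuousOn (fun q : W × ℝ => q.2 - φ q.1) (Prod.fst ⁻¹' interior U) :=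
      continuousOn_snd.sub
        ((hc.mono interior_subset).comp continuousOn_fst (fun _ hq => hq))
    have := hcont.isOpen_inter_preimage (isOpen_interior.preimage continuous_fst)
      (isOpen_Ioi (a := (0 : ℝ)))
    convert this using 1
    ext q
    simp
  -- `L` separates the open strict epigraph from the boundary point `(w, φ w)`. Its vertical slope
  -- `c` is negative, so dividing by `-c` gives the subgradient.
  obtain ⟨L, hL⟩ := geometric_hahn_banach_open_point (x := (w, φ w)) hconv hopen (by simp)
  set c : ℝ := L (0, 1) with hc_def
  have hsplit : ∀ (u : W) (r : ℝ), L (u, r) = L (u, 0) + r * c := by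
    intro u r
    have : ((u, r) : W × ℝ) = (u, 0) + r • (0, 1) := by simp
    rw [this, map_add, map_smul, smul_eq_mul]
  have hcneg : c < 0 := by
    have h := hL (w, φ w + 1) ⟨hw, by simp⟩
    rw [hsplit, hsplit w (φ w)] at h
    linarith
  have hle : ∀ u ∈ interior U, L (u, 0) + φ u * c ≤ L (w, 0) + φ w * c := by
    intro u hu
    refine le_of_forall_pos_le_add fun ε hε => ?_
    have h := hL (u, φ u + ε / (-c)) ⟨hu, by
      have : 0 < ε / (-c) := div_pos hε (by linarith)
      simpa using this⟩
    rw [hsplit, hsplit w (φ w)] at h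
    have h2 : ε / (-c) * c = -ε := by
      have := hcneg.ne
      field_simp
    nlinarith
  have hint : ∀ u ∈ interior U,
      φ w + ((-c)⁻¹ • L.comp (ContinuousLinearMap.inl ℝ W ℝ)) (u - w) ≤ φ u := by
    intro u hu
    have h := hle u hu
    have h3 : L (u - w, 0) = L (u, 0) - L (w, 0) := by
      rw [← map_sub]
      simp
    simp only [smul_apply, ContinuousLinearMap.comp_apply,
      ContinuousLinearMap.inl_apply, smul_eq_mul, h3]
    have h4 : (-c)⁻¹ * (L (u, 0) - L (w, 0)) ≤ φ u - φ w := by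
      rw [inv_mul_le_iff₀ (by linarith)]
      linarith
    linarith
  refine ⟨(-c)⁻¹ • L.comp (ContinuousLinearMap.inl ℝ W ℝ), fun u hu => ?_⟩
  -- So far the inequality holds only on the interior. The midpoint of `w` and any `u ∈ U` is
  -- interior, and convexity there carries the inequality over to `u`.
  have hm : (1 / 2 : ℝ) • w + (1 / 2 : ℝ) • u ∈ interior U :=
    hφ.1.combo_interior_self_mem_interior hw hu (by norm_num) (by norm_num) (by norm_num)
  have h1 := hint _ hm
  have h2 := hφ.2 (interior_subset hw) hu (show (0 : ℝ) ≤ 1 / 2 by norm_num)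
    (show (0 : ℝ) ≤ 1 / 2 by norm_num) (by norm_num)
  have h3 : (1 / 2 : ℝ) • w + (1 / 2 : ℝ) • u - w = (1 / 2 : ℝ) • (u - w) := by
    module
  rw [h3, map_smul] at h1
  simp only [smul_eq_mul] at h1 h2
  linarith

/-! ### Subgradients, Bregman divergence and the prox-mapping -/

section Subdifferential

variable {V : Type*} [NormedAddCommGroup V] [NormedSpace ℝ V]

/-- In finite dimension, the domain of the subdifferential contains a dense subset of `X` which
absorbs the segments ending in it, namely the relative interior of `X`. -/
theorem exists_dense_subset_domSubdiff [FiniteDimensional ℝ V] {X : Set V} {h : V → ℝ}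
    (hX : Convex ℝ X) (hne : X.Nonempty) (hconv : ConvexOn ℝ X h) (hc : ContinuousOn h X) :
    ∃ R ⊆ domSubdiff X h, X ⊆ closure R ∧
      ∀ x ∈ X, ∀ r ∈ R, ∀ t ∈ Set.Ioc (0 : ℝ) 1, x + t • (r - x) ∈ R := by
  obtain ⟨p, hp⟩ := hne.intrinsicInterior hX
  obtain ⟨q, hq, rfl⟩ := mem_intrinsicInterior.1 hp
  -- Translating by `q` into the direction space turns the relative interior of `X` into an honest
  -- interior, where subgradients exist.
  let W := (affineSpan ℝ X).direction
  set U : Set W := {w | (q : V) + (w : V) ∈ X} with hU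
  have hUconv : Convex ℝ U := by
    intro a ha b hb s t hs ht hst
    have := hX ha hb hs ht hst
    simp only [hU, Set.mem_ofPred_eq, Submodule.coe_add, Submodule.coe_smul] at this ⊢
    convert this using 1
    have hs' : s = 1 - t := by linarith
    subst hs'
    module
  have hcont : Continuous fun w : W => (q : V) + (w : V) := by fun_prop
  have hU0 : (0 : W) ∈ interior U := by
    rw [mem_interior_iff_mem_nhds] at hq ⊢
    have hcont' : Continuous fun w : W => (⟨(w : V) + q,
        AffineSubspace.vadd_mem_of_mem_direction w.2 q.2⟩ : affineSpan ℝ X) := by fun_prop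
    have := hcont'.continuousAt.preimage_mem_nhds (x := 0) (t := ((↑) ⁻¹' X)) (by simpa using hq)
    filter_upwards [this] with w hw
    simpa [hU, add_comm] using hw
  have hlift : ∀ x ∈ X, ∃ w ∈ U, (q : V) + (w : V) = x := by
    intro x hx
    refine ⟨⟨x - q, AffineSubspace.vsub_mem_direction (subset_affineSpan ℝ X hx) q.2⟩, ?_, ?_⟩
    · simpa [hU] using hx
    · simp
  have hconvU : ConvexOn ℝ U fun w => h (q + w) := by
    refine ⟨hUconv, fun a ha b hb s t hs ht hst => ?_⟩
    have := hconv.2 ha hb hs ht hst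
    convert this using 2
    have hs' : s = 1 - t := by linarith
    subst hs'
    push_cast
    module
  have hcontU : ContinuousOn (fun w : W => h (q + w)) U := hc.comp hcont.continuousOn fun _ hw => hw
  refine ⟨(fun w : W => (q : V) + (w : V)) '' interior U, ?_, ?_, ?_⟩
  · rintro _ ⟨w, hw, rfl⟩
    refine ⟨interior_subset (s := U) hw, ?_⟩
    obtain ⟨y, hy⟩ := hconvU.exists_subgradient_of_mem_interior hcontU hw
    -- Any extension works: differences of points of `X` lie in `W`.
    obtain ⟨Y, hY⟩ := LinearMap.exists_extend y.toLinearMap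
    refine ⟨Y.toContinuousLinearMap, fun x' hx' => ?_⟩
    obtain ⟨w', hw', rfl⟩ := hlift x' hx'
    have h1 := hy w' hw'
    have h2 : Y ((w' - w : W) : V) = y (w' - w) := LinearMap.congr_fun hY (w' - w)
    simp only [LinearMap.coe_toContinuousLinearMap', add_sub_add_left_eq_sub]
    rw [Submodule.coe_sub] at h2
    rw [h2]
    exact h1
  · intro x hx
    obtain ⟨w, hw, rfl⟩ := hlift x hx
    have h1 : w ∈ closure (interior U) := by
      rw [hUconv.closure_interior_eq_closure_of_nonempty_interior ⟨0, hU0⟩]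
      exact subset_closure hw
    exact image_closure_subset_closure_image hcont ⟨w, h1, rfl⟩
  · rintro x hx _ ⟨r, hr, rfl⟩ t ht
    obtain ⟨w, hw, rfl⟩ := hlift x hx
    refine ⟨w + t • (r - w), hUconv.add_smul_sub_mem_interior hw hr ht, ?_⟩
    push_cast
    module

theorem IsDGF.convexOn {X : Set V} {K : ℝ} {h : V → ℝ} {dh : V → StrongDual ℝ V}
    (hh : IsDGF X K h dh) : ConvexOn ℝ X h :=
  (UniformConvexOn.convexOn hh.strongConvexOn fun r => by
    have := hh.pos
    positivity)

/-- Among all subgradients, a continuous selection of the subdifferential has the least pairing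
with every feasible direction. -/
theorem IsDGF.selection_apply_ge [FiniteDimensional ℝ V] {X : Set V} {K : ℝ} {h : V → ℝ}
    {dh : V → StrongDual ℝ V} (hX : Convex ℝ X) (hh : IsDGF X K h dh)
    {x p : V} (hx : x ∈ domSubdiff X h) (hp : p ∈ X) {y : StrongDual ℝ V}
    (hy : y ∈ subdiff X h x) : y (p - x) ≤ dh x (p - x) := by
  obtain ⟨R, hRdom, hRdense, hRseg⟩ :=
    exists_dense_subset_domSubdiff hX ⟨p, hp⟩ hh.convexOn hh.continuousOn
  have hR : ∀ r ∈ R, y (r - x) ≤ dh x (r - x) := by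
    intro r hr
    have hlim : Tendsto (fun t : ℝ => x + t • (r - x)) (𝓝[>] 0) (𝓝[domSubdiff X h] x) := by
      refine tendsto_nhdsWithin_iff.2 ⟨?_, ?_⟩
      · have : Continuous fun t : ℝ => x + t • (r - x) := by fun_prop
        have h0 := this.tendsto 0
        simp only [zero_smul, add_zero] at h0
        exact h0.mono_left nhdsWithin_le_nhds
      · filter_upwards [Ioc_mem_nhdsGT (zero_lt_one' ℝ)] with t ht
        exact hRdom (hRseg x hx.1 r hr t ht)
    have hlim2 : Tendsto (fun t : ℝ => dh (x + t • (r - x)) (r - x)) (𝓝[>] 0)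
        (𝓝 (dh x (r - x))) := by
      have h1 : Tendsto (fun t : ℝ => dh (x + t • (r - x))) (𝓝[>] 0) (𝓝 (dh x)) :=
        (hh.continuousOn_selection x hx).tendsto.comp hlim
      exact ((ContinuousLinearMap.apply ℝ ℝ (r - x)).continuous.tendsto _).comp h1
    refine ge_of_tendsto hlim2 ?_
    filter_upwards [Ioc_mem_nhdsGT (zero_lt_one' ℝ)] with t ht
    -- Monotonicity of the subdifferential between `x` and `x + t • (r - x)`, divided by `t`;
    -- continuity of `dh` then gives the limit `t → 0`.
    have hz := hRdom (hRseg x hx.1 r hr t ht)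
    have h1 := hh.selection _ hz x hx.1
    have h2 := hy _ hz.1
    have e1 : x - (x + t • (r - x)) = -(t • (r - x)) := by module
    have e2 : x + t • (r - x) - x = t • (r - x) := by module
    rw [e1, map_neg, map_smul, smul_eq_mul] at h1
    rw [e2, map_smul, smul_eq_mul] at h2
    exact le_of_mul_le_mul_left (by linarith) ht.1
  have hclosed : IsClosed {r : V | y (r - x) ≤ dh x (r - x)} :=
    isClosed_le (by fun_prop) (by fun_prop)
  exact hclosed.closure_subset_iff.2 hR (hRdense hp)

/-- The Bregman divergence dominates the squared distance. -/
theorem IsDGF.le_bregman {X : Set V} {K : ℝ} {h : V → ℝ} {dh : V → StrongDual ℝ V}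
    (hh : IsDGF X K h dh) {x p : V} (hx : x ∈ domSubdiff X h) (hp : p ∈ X) :
    K / 2 * ‖p - x‖ ^ 2 ≤ bregman h dh p x := by
  -- Strong convexity and the subgradient inequality at the same intermediate point, divided by `t`;
  -- the factor `1 - t` disappears as `t → 0`.
  have key : ∀ t ∈ Set.Ioo (0 : ℝ) 1, (1 - t) * (K / 2 * ‖p - x‖ ^ 2) ≤ bregman h dh p x := by
    intro t ht
    have h1 := hh.strongConvexOn.2 hx.1 hp (sub_nonneg.2 ht.2.le) ht.1.le
      (by ring)
    have hz : (1 - t) • x + t • p ∈ X :=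
      hh.strongConvexOn.1 hx.1 hp (sub_nonneg.2 ht.2.le) ht.1.le
        (by ring)
    have h2 := hh.selection x hx _ hz
    have e : (1 - t) • x + t • p - x = t • (p - x) := by module
    rw [e, map_smul, smul_eq_mul] at h2
    simp only [smul_eq_mul, norm_sub_rev x p] at h1
    unfold bregman
    refine le_of_mul_le_mul_left ?_ ht.1
    nlinarith
  have hlim : Tendsto (fun t : ℝ => (1 - t) * (K / 2 * ‖p - x‖ ^ 2)) (𝓝[>] 0)
      (𝓝 ((1 - 0) * (K / 2 * ‖p - x‖ ^ 2))) :=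
    (Continuous.tendsto (by fun_prop) 0).mono_left nhdsWithin_le_nhds
  have := le_of_tendsto hlim (by
    filter_upwards [Ioo_mem_nhdsGT (zero_lt_one' ℝ)] with t ht using key t ht)
  simpa using this

/-- Fermat's rule for the prox problem: its objective is `h` minus the linear form `dh x + y`, up to
a constant, so minimality is itself the subgradient inequality. -/
theorem IsProx.mem_subdiff {X : Set V} {h : V → ℝ} {dh : V → StrongDual ℝ V} {x x' : V}
    {y : StrongDual ℝ V} (hx' : IsProx X h dh x y x') : dh x + y ∈ subdiff X h x' := by
  intro z hz
  have h1 : y (x - x') + bregman h dh x' x ≤ y (x - z) + bregman h dh z x := hx'.2 hz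
  simp only [bregman, add_apply, map_sub] at h1 ⊢
  linarith

theorem IsProx.mem_domSubdiff {X : Set V} {h : V → ℝ} {dh : V → StrongDual ℝ V} {x x' : V}
    {y : StrongDual ℝ V} (hx' : IsProx X h dh x y x') : x' ∈ domSubdiff X h :=
  ⟨hx'.1, _, hx'.mem_subdiff⟩

/-- One-step energy inequality for the prox-mapping. -/
theorem IsProx.bregman_le [FiniteDimensional ℝ V] {X : Set V} {K : ℝ} {h : V → ℝ}
    {dh : V → StrongDual ℝ V} (hX : Convex ℝ X) (hh : IsDGF X K h dh)
    {x x' p : V} {y : StrongDual ℝ V} (hx : x ∈ domSubdiff X h) (hp : p ∈ X) (hx' : IsProx X h dh x y x') :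
    bregman h dh p x' ≤ bregman h dh p x + (y (x - p) + (2 * K)⁻¹ * ‖y‖ ^ 2) := by
  have h1 := hh.selection_apply_ge hX hx'.mem_domSubdiff hp hx'.mem_subdiff
  have h2 := hh.le_bregman hx hx'.1
  have h3 : y (x' - x) ≤ ‖y‖ * ‖x' - x‖ := (le_abs_self _).trans (y.le_opNorm _)
  have hK := hh.pos
  -- Young's inequality, weighted so that the quadratic term is absorbed by the strong convexity
  -- bound `h2`.
  have h4 : ‖y‖ * ‖x' - x‖ ≤ K / 2 * ‖x' - x‖ ^ 2 + (2 * K)⁻¹ * ‖y‖ ^ 2 := by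
    have : K / 2 * ‖x' - x‖ ^ 2 + (2 * K)⁻¹ * ‖y‖ ^ 2 - ‖y‖ * ‖x' - x‖
        = (2 * K)⁻¹ * (K * ‖x' - x‖ - ‖y‖) ^ 2 := by
      field_simp
      ring
    have h5 : 0 ≤ (2 * K)⁻¹ * (K * ‖x' - x‖ - ‖y‖) ^ 2 := by positivity
    linarith
  simp only [bregman, add_apply, map_sub] at h1 h2 h3 ⊢
  linarith

end Subdifferential

/-! ### Almost supermartingales -/

section RobbinsSiegmund

variable {Ω : Type*} {m0 : MeasurableSpace Ω} {μ : Measure Ω} [IsFiniteMeasure μ]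

/-- A supermartingale which is bounded below by a constant converges almost surely. -/
theorem MeasureTheory.Supermartingale.exists_ae_tendsto_of_bddBelow {ℱ : Filtration ℕ m0}
    {S : ℕ → Ω → ℝ} (hS : Supermartingale S ℱ μ) {C : ℝ} (hC : ∀ n ω, -C ≤ S n ω) :
    ∀ᵐ ω ∂μ, ∃ c, Tendsto (fun n => S n ω) atTop (𝓝 c) := by
  have hint : ∀ n, ∫ ω, |S n ω| ∂μ ≤ ∫ ω, S 0 ω + 2 * |C| ∂μ := by
    intro n
    have h1 : ∫ ω, |S n ω| ∂μ ≤ ∫ ω, S n ω + 2 * |C| ∂μ := by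
      refine integral_mono (hS.integrable n).abs
        ((hS.integrable n).add (integrable_const _)) fun ω => ?_
      have := hC n ω
      have h2 := le_abs_self C
      have h3 := abs_nonneg C
      exact abs_le.2 ⟨by linarith, by linarith⟩
    refine h1.trans ?_
    rw [integral_add (hS.integrable n) (integrable_const _),
      integral_add (hS.integrable 0) (integrable_const _)]
    have h4 := hS.setIntegral_le (Nat.zero_le n) (s := Set.univ) MeasurableSet.univ
    simp only [Measure.restrict_univ] at h4
    linarith
  have hbdd : ∀ n, eLpNorm ((-S) n) 1 μ ≤ (∫ ω, S 0 ω + 2 * |C| ∂μ).toNNReal := by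
    intro n
    have h1 : eLpNorm ((-S) n) 1 μ = eLpNorm (S n) 1 μ := eLpNorm_neg _ _ _
    rw [h1, eLpNorm_one_eq_lintegral_enorm,
      ← ofReal_integral_norm_eq_lintegral_enorm (hS.integrable n)]
    exact ENNReal.ofReal_le_ofReal (hint n)
  filter_upwards [hS.neg.exists_ae_tendsto_of_bdd hbdd] with ω ⟨c, hc⟩
  exact ⟨-c, by simpa using hc.neg⟩

/-- **Robbins–Siegmund lemma**, for an energy `D` which decreases by `v` in conditional mean, up to
a summable deterministic error; the initial energy need not be integrable. -/
theorem ae_tendsto_and_summable_of_condExp_le {ℱ : Filtration ℕ m0} {D v R : ℕ → Ω → ℝ} {c : ℕ → ℝ}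
    (hD : StronglyAdapted ℱ D) (hD0 : ∀ n ω, 0 ≤ D n ω)
    (hv : StronglyAdapted ℱ v) (hv0 : ∀ n ω, 0 ≤ v n ω) (hvi : ∀ n, Integrable (v n) μ)
    (hR : ∀ n, Integrable (R n) μ) (hc0 : ∀ n, 0 ≤ c n) (hc : Summable c)
    (hstep : ∀ n, ∀ᵐ ω ∂μ, D (n + 1) ω ≤ D n ω + R n ω)
    (hcond : ∀ n, ∀ᵐ ω ∂μ, (μ[R n | ℱ n]) ω ≤ -v n ω + c n) :
    ∀ᵐ ω ∂μ, (∃ d, Tendsto (fun n => D n ω) atTop (𝓝 d)) ∧ Summable fun n => v n ω := by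
  -- Localization: `D 0` is bounded on `A M`, an event known at time `0`, so multiplying by its
  -- indicator restores integrability and keeps the supermartingale property. The events `A M`
  -- exhaust `Ω`.
  set A : ℕ → Set Ω := fun M => {ω | D 0 ω ≤ M} with hA
  have hAmeas : ∀ M n, MeasurableSet[ℱ n] (A M) := fun M n =>
    ℱ.mono (Nat.zero_le n) _ ((hD 0).measurable measurableSet_Iic)
  have hAmeas' : ∀ M, MeasurableSet (A M) := fun M => ℱ.le 0 _ (hAmeas M 0)
  -- Adding the past decreases and subtracting the past errors turns the drift bound into a
  -- supermartingale, bounded below by `-∑' k, c k`.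
  set S : ℕ → Ω → ℝ := fun n ω =>
    D n ω + ∑ k ∈ Finset.range n, v k ω - ∑ k ∈ Finset.range n, c k with hS
  have hSadapted : StronglyAdapted ℱ S := by
    intro n
    refine ((hD n).add ?_).sub stronglyMeasurable_const
    exact Finset.stronglyMeasurable_fun_sum _ fun k hk =>
      (hv k).mono (ℱ.mono (Finset.mem_range.1 hk).le)
  have hDint : ∀ M n, Integrable ((A M).indicator (D n)) μ := by
    intro M n
    induction n with
    | zero =>
      refine Integrable.of_bound (C := M)
        (((hD 0).mono (ℱ.le 0)).indicator (hAmeas' M)).aestronglyMeasurable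
        (Eventually.of_forall fun ω => ?_)
      by_cases h : ω ∈ A M
      · rw [Set.indicator_of_mem h, Real.norm_of_nonneg (hD0 0 ω)]
        exact h
      · rw [Set.indicator_of_notMem h]
        simp
    | succ n ih =>
      refine (ih.add ((hR n).indicator (hAmeas' M))).mono'
        (((hD (n + 1)).mono (ℱ.le _)).indicator (hAmeas' M)).aestronglyMeasurable ?_
      filter_upwards [hstep n] with ω hω
      by_cases h : ω ∈ A M
      · simp only [Pi.add_apply, Set.indicator_of_mem h, Real.norm_of_nonneg (hD0 (n + 1) ω)]
        exact hω
      · simp [Set.indicator_of_notMem h]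
  have hSint : ∀ M n, Integrable ((A M).indicator (S n)) μ := by
    intro M n
    have h1 : Integrable ((A M).indicator fun ω =>
        ∑ k ∈ Finset.range n, v k ω - ∑ k ∈ Finset.range n, c k) μ :=
      ((integrable_finsetSum _ fun k _ => hvi k).sub (integrable_const _)).indicator (hAmeas' M)
    refine ((hDint M n).add h1).congr (Eventually.of_forall fun ω => ?_)
    by_cases h : ω ∈ A M
    · simp only [Pi.add_apply, Set.indicator_of_mem h, hS]
      ring
    · simp [Set.indicator_of_notMem h]
  have hsuper : ∀ M, Supermartingale (fun n => (A M).indicator (S n)) ℱ μ := by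
    intro M
    refine supermartingale_nat (fun n => (hSadapted n).indicator (hAmeas M n)) (hSint M)
      fun n => ?_
    have hle : (A M).indicator (S (n + 1)) ≤ᵐ[μ]
        (A M).indicator (S n) + (A M).indicator (R n + fun ω => v n ω - c n) := by
      filter_upwards [hstep n] with ω hω
      by_cases h : ω ∈ A M
      · simp only [Pi.add_apply, Set.indicator_of_mem h, hS, Finset.sum_range_succ]
        linarith
      · simp [Set.indicator_of_notMem h]
    have hvc : Integrable (fun ω => v n ω - c n) μ := (hvi n).sub (integrable_const _)
    have hQ : Integrable (R n + fun ω => v n ω - c n) μ := (hR n).add hvc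
    have h1 := condExp_mono (m := ℱ n) (hSint M (n + 1))
      ((hSint M n).add (hQ.indicator (hAmeas' M))) hle
    have h2 := condExp_add (hSint M n) (hQ.indicator (hAmeas' M)) (ℱ n)
    have h3 := condExp_indicator hQ (hAmeas M n)
    have h4 := condExp_add (hR n) hvc (ℱ n)
    have h5 : μ[(A M).indicator (S n) | ℱ n] = (A M).indicator (S n) :=
      condExp_of_stronglyMeasurable (ℱ.le n) ((hSadapted n).indicator (hAmeas M n)) (hSint M n)
    have h6 : μ[fun ω => v n ω - c n | ℱ n] = fun ω => v n ω - c n :=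
      condExp_of_stronglyMeasurable (ℱ.le n) ((hv n).sub stronglyMeasurable_const) hvc
    filter_upwards [h1, h2, h3, h4, hcond n] with ω w1 w2 w3 w4 w5
    rw [w2, Pi.add_apply, h5, w3] at w1
    refine w1.trans ?_
    by_cases h : ω ∈ A M
    · rw [Set.indicator_of_mem h, Set.indicator_of_mem h, w4, Pi.add_apply, h6]
      linarith
    · simp [Set.indicator_of_notMem h]
  have hcsum : ∀ n, ∑ k ∈ Finset.range n, c k ≤ ∑' k, c k := fun n =>
    hc.sum_le_tsum _ fun k _ => hc0 k
  have htsum : 0 ≤ ∑' k, c k := tsum_nonneg hc0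
  have hconv : ∀ᵐ ω ∂μ, ∀ M : ℕ, ∃ s, Tendsto (fun n => (A M).indicator (S n) ω) atTop (𝓝 s) := by
    refine ae_all_iff.2 fun M => (hsuper M).exists_ae_tendsto_of_bddBelow (C := ∑' k, c k) ?_
    intro n ω
    by_cases h : ω ∈ A M
    · simp only [Set.indicator_of_mem h, hS]
      have h1 := hD0 n ω
      have h2 : 0 ≤ ∑ k ∈ Finset.range n, v k ω := Finset.sum_nonneg fun k _ => hv0 k ω
      linarith [hcsum n]
    · simpa [Set.indicator_of_notMem h] using htsum
  filter_upwards [hconv] with ω hω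
  obtain ⟨M, hM⟩ := exists_nat_ge (D 0 ω)
  obtain ⟨s, hs⟩ := hω M
  have hmem : ω ∈ A M := hM
  simp only [Set.indicator_of_mem hmem] at hs
  obtain ⟨B, hB⟩ := hs.bddAbove_range
  have hsum : Summable fun n => v n ω := by
    refine summable_of_sum_range_le (c := B + ∑' k, c k) (fun n => hv0 n ω) fun n => ?_
    have h1 : S n ω ≤ B := hB ⟨n, rfl⟩
    simp only [hS] at h1
    linarith [hD0 n ω, hcsum n]
  refine ⟨⟨_, ((hs.sub hsum.hasSum.tendsto_sum_nat).add hc.hasSum.tendsto_sum_nat).congr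
    fun n => ?_⟩, hsum⟩
  simp only [hS]
  ring

end RobbinsSiegmund

/-! ### Almost sure convergence under a strict variational inequality -/

section MirrorDescentConvergence

variable {V : Type*} [NormedAddCommGroup V] [NormedSpace ℝ V]

/-- The domain of the subdifferential of a continuous function on a compact set is Borel. -/
theorem measurableSet_domSubdiff [FiniteDimensional ℝ V] [MeasurableSpace V] [BorelSpace V]
    {X : Set V} {h : V → ℝ} (hX : IsCompact X) (hc : ContinuousOn h X) :
    MeasurableSet (domSubdiff X h) := by
  have : ProperSpace (StrongDual ℝ V) := FiniteDimensional.proper_real _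
  set P : ℕ → Set (V × StrongDual ℝ V) := fun N => X ×ˢ Metric.closedBall 0 N with hP
  have hPc : ∀ N, IsCompact (P N) := fun N => hX.prod (isCompact_closedBall _ _)
  -- `T N` is the graph of the subdifferential cut off at dual norm `N`. It is compact, so its
  -- projection is closed and the domain is a countable union of closed sets.
  set T : ℕ → Set (V × StrongDual ℝ V) := fun N =>
    P N ∩ ⋂ x' ∈ X, P N ∩ (fun q => h q.1 + q.2 (x' - q.1) - h x') ⁻¹' Set.Iic 0 with hT
  have hTc : ∀ N, IsCompact (T N) := by
    intro N
    refine (hPc N).inter_right (isClosed_biInter fun x' _ => ?_)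
    refine ContinuousOn.preimage_isClosed_of_isClosed ?_ (hPc N).isClosed isClosed_Iic
    have h1 : ContinuousOn (fun q : V × StrongDual ℝ V => h q.1) (P N) :=
      hc.comp continuousOn_fst fun q hq => hq.1
    have h2 : Continuous fun q : V × StrongDual ℝ V => q.2 (x' - q.1) := by fun_prop
    exact (h1.add h2.continuousOn).sub continuousOn_const
  have hdom : domSubdiff X h = ⋃ N, Prod.fst '' T N := by
    ext x
    simp only [Set.mem_iUnion, Set.mem_image, Prod.exists, exists_and_right, exists_eq_right]
    constructor
    · rintro ⟨hx, y, hy⟩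
      obtain ⟨N, hN⟩ := exists_nat_ge ‖y‖
      have hmem : (x, y) ∈ P N := ⟨hx, by simpa using hN⟩
      refine ⟨N, y, hmem, Set.mem_iInter₂.2 fun x' hx' => ⟨hmem, ?_⟩⟩
      have := hy x' hx'
      simp only [Set.mem_preimage, Set.mem_Iic]
      linarith
    · rintro ⟨N, y, hmem, hy⟩
      refine ⟨hmem.1, y, fun x' hx' => ?_⟩
      have := (Set.mem_iInter₂.1 hy x' hx').2
      simp only [Set.mem_preimage, Set.mem_Iic] at this
      linarith
  rw [hdom]
  exact MeasurableSet.iUnion fun N => ((hTc N).image continuous_fst).isClosed.measurableSet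

theorem ContinuousOn.measurable_indicator {α : Type*} [TopologicalSpace α] [MeasurableSpace α]
    [BorelSpace α] {s : Set α} {f : α → ℝ} (hf : ContinuousOn f s) (hs : MeasurableSet s) :
    Measurable (s.indicator f) := by
  classical
  rw [← Set.piecewise_eq_indicator]
  exact hf.measurable_piecewise continuousOn_const hs

theorem IsDGF.continuousOn_bregman {X : Set V} {K : ℝ} {h : V → ℝ} {dh : V → StrongDual ℝ V}
    (hh : IsDGF X K h dh) (p : V) : ContinuousOn (bregman h dh p) (domSubdiff X h) := by
  have h1 : ContinuousOn h (domSubdiff X h) := hh.continuousOn.mono fun x hx => hx.1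
  have h2 : ContinuousOn (fun x => dh x (p - x)) (domSubdiff X h) :=
    hh.continuousOn_selection.clm_apply (by fun_prop)
  exact (continuousOn_const.sub h1).sub h2

/-- A sequence whose Bregman divergence to `p` converges and along which the weighted gaps of `p`
are summable converges to `p`. -/
theorem IsDGF.tendsto_of_tendsto_bregman {X : Set V} {K : ℝ} {h : V → ℝ} {dh : V → StrongDual ℝ V}
    (hX : IsCompact X) (hh : IsDGF X K h dh) {p : V} (hp : p ∈ X) {w : V → ℝ}
    (hw : ContinuousOn w X) (hw0 : ∀ x ∈ X, x ≠ p → 0 < w x)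
    {γ : ℕ → ℝ} (hγ_pos : ∀ n, 0 < γ n)
    (hγ_sum : Tendsto (fun n => ∑ k ∈ Finset.range n, γ k) atTop atTop)
    {x : ℕ → V} (hx : ∀ n, x n ∈ domSubdiff X h)
    {d : ℝ} (hd : Tendsto (fun n => bregman h dh p (x n)) atTop (𝓝 d))
    (hsum : Summable fun n => γ n * w (x n)) : Tendsto x atTop (𝓝 p) := by
  -- If the gap eventually stayed above `1 / (k + 1)`, then `γ` would be dominated by a multiple of
  -- the summable weighted gaps.
  have hfreq : ∀ k : ℕ, ∃ᶠ n in atTop, w (x n) < 1 / ((k : ℝ) + 1) := by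
    intro k hk
    have hev : ∀ᶠ n in atTop, ‖γ n‖ ≤ ((k : ℝ) + 1) * (γ n * w (x n)) := by
      filter_upwards [hk] with n hn
      rw [not_lt, div_le_iff₀ (by positivity)] at hn
      rw [Real.norm_of_nonneg (hγ_pos n).le]
      nlinarith [hγ_pos n]
    have hs : Summable γ := (hsum.mul_left _).of_norm_bounded_eventually_nat hev
    exact (not_summable_iff_tendsto_nat_atTop_of_nonneg fun n => (hγ_pos n).le).2 hγ_sum hs
  obtain ⟨φ, hφ, hφw⟩ := extraction_forall_of_frequently hfreq
  obtain ⟨q, hq, ψ, hψ, hlim⟩ := hX.tendsto_subseq (x := fun k => x (φ k)) fun k => (hx _).1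
  have hwq : w q ≤ 0 := by
    have h1 : Tendsto (fun k => w (x (φ (ψ k)))) atTop (𝓝 (w q)) :=
      (hw q hq).tendsto.comp
        (tendsto_nhdsWithin_iff.2 ⟨hlim, Eventually.of_forall fun k => (hx _).1⟩)
    exact le_of_tendsto_of_tendsto' h1
      (tendsto_one_div_add_atTop_nhds_zero_nat.comp hψ.tendsto_atTop) fun k => (hφw _).le
  have hqp : q = p := by
    by_contra hne
    exact absurd (hw0 q hq hne) (not_lt.2 hwq)
  subst hqp
  have h0 := hh.reciprocity q hq _ (fun k => hx (φ (ψ k))) hlim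
  -- The divergence already has a limit, so reciprocity along one subsequence determines it.
  have hd0 : d = 0 :=
    tendsto_nhds_unique (hd.comp (hφ.comp hψ).tendsto_atTop) h0
  rw [hd0] at hd
  have hK := hh.pos
  have hsq : Tendsto (fun n => ‖q - x n‖ ^ 2) atTop (𝓝 0) := by
    refine squeeze_zero (fun n => by positivity) (fun n => ?_) (by simpa using hd.const_mul (2 / K))
    have := hh.le_bregman (hx n) hq
    calc ‖q - x n‖ ^ 2 = 2 / K * (K / 2 * ‖q - x n‖ ^ 2) := by field_simp
      _ ≤ 2 / K * bregman h dh q (x n) := by gcongr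
  have hnorm : Tendsto (fun n => ‖q - x n‖) atTop (𝓝 0) := by
    have := hsq.sqrt
    simpa [Real.sqrt_sq (norm_nonneg _)] using this
  rw [tendsto_iff_norm_sub_tendsto_zero]
  simpa only [norm_sub_rev] using hnorm

/-- Stochastic mirror descent converges almost surely to a strict solution `p` of the variational
inequality of its gradient field. -/
theorem IsMirrorDescent.ae_tendsto [FiniteDimensional ℝ V] {Ω : Type*} [MeasurableSpace Ω]
    {μ : Measure Ω} [IsProbabilityMeasure μ] {X : Set V} (hXc : IsCompact X) (hX : Convex ℝ X)
    {K : ℝ} {h : V → ℝ} {dh : V → StrongDual ℝ V} (hh : IsDGF X K h dh)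
    {γ : ℕ → ℝ} (hγ_pos : ∀ n, 0 < γ n)
    (hγ_sum : Tendsto (fun n => ∑ k ∈ Finset.range n, γ k) atTop atTop)
    (hγ_sq : Summable (fun n => γ n ^ 2))
    {g : V → StrongDual ℝ V} (hg : ContinuousOn g X) {p : V} (hp : p ∈ X)
    (hgp : ∀ x ∈ X, x ≠ p → 0 < g x (x - p))
    {G : ℝ} {gh : ℕ → Ω → StrongDual ℝ V} {Xs : ℕ → Ω → V}
    (hMD : IsMirrorDescent μ X h dh γ gh Xs) (hOracle : IsStochasticOracle μ g G gh Xs) :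
    ∀ᵐ ω ∂μ, Tendsto (fun n => Xs n ω) atTop (𝓝 p) := by
  let _ : MeasurableSpace V := borel V
  have : BorelSpace V := ⟨rfl⟩
  have hK := hh.pos
  have hgp0 : ∀ x ∈ X, 0 ≤ g x (x - p) := by
    intro x hx
    rcases eq_or_ne x p with rfl | hne
    · simp
    · exact (hgp x hx hne).le
  have hXsm : ∀ n, Measurable (Xs n) := fun n => (hMD.stronglyMeasurable n).measurable
  let ℱ : Filtration ℕ ‹MeasurableSpace Ω› :=
    { seq := history Xs
      mono' := fun i j hij => biSup_mono fun k hk => le_trans hk hij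
      le' := fun n => iSup₂_le fun k _ => (hXsm k).comap_le }
  have hXadapted : ∀ n, Measurable[ℱ n] (Xs n) := fun n =>
    measurable_iff_comap_le.2 (le_iSup₂_of_le (f := fun k (_ : k ≤ n) => (borel V).comap (Xs k))
      n le_rfl le_rfl)
  have hdom : ∀ᵐ ω ∂μ, ∀ n, Xs n ω ∈ domSubdiff X h := by
    refine ae_all_iff.2 fun n => ?_
    cases n with
    | zero => exact hMD.init
    | succ n => filter_upwards [hMD.step n] with ω hω using hω.mem_domSubdiff
  have hw : ContinuousOn (fun x => g x (x - p)) X := hg.clm_apply (by fun_prop)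
  -- Continuity holds only relative to the domain, and the iterates lie there only almost surely.
  -- Extending by zero gives globally measurable, nonnegative functions that agree almost surely
  -- with the divergence and the gap along the process.
  set Df : V → ℝ := (domSubdiff X h).indicator (bregman h dh p) with hDf
  set wf : V → ℝ := X.indicator (fun x => g x (x - p)) with hwf
  have hDf_meas : Measurable Df :=
    (hh.continuousOn_bregman p).measurable_indicator
      (measurableSet_domSubdiff hXc hh.continuousOn)
  have hwf_meas : Measurable wf := hw.measurable_indicator hXc.measurableSet
  have hDf0 : ∀ x, 0 ≤ Df x := Set.indicator_nonneg fun x hx =>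
    le_trans (by positivity) (hh.le_bregman hx hp)
  have hwf0 : ∀ x, 0 ≤ wf x := Set.indicator_nonneg hgp0
  have hghi : ∀ n, Integrable (gh n) μ := fun n => (hOracle.memLp n).integrable one_le_two
  have hghsq : ∀ n, Integrable (fun ω => ‖gh n ω‖ ^ 2) μ := fun n =>
    (hOracle.memLp n).integrable_norm_pow two_ne_zero
  obtain ⟨C, hC⟩ := hXc.exists_bound_of_continuousOn (f := fun x => x - p) (by fun_prop)
  have hpair : ∀ n, Integrable (fun ω => gh n ω (Xs n ω - p)) μ := by
    intro n
    refine ((hghi n).norm.mul_const C).mono' ?_ ?_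
    · exact isBoundedBilinearMap_apply.continuous.comp_aestronglyMeasurable
        ((hghi n).aestronglyMeasurable.prodMk
          ((hMD.stronglyMeasurable n).sub stronglyMeasurable_const).aestronglyMeasurable)
    · filter_upwards [hdom] with ω hω
      refine ((gh n ω).le_opNorm _).trans ?_
      gcongr
      exact hC _ (hω n).1
  obtain ⟨C', hC'⟩ := hXc.exists_bound_of_continuousOn hw
  have hwi : ∀ n, Integrable (fun ω => γ n * wf (Xs n ω)) μ := by
    intro n
    refine Integrable.const_mul (Integrable.of_bound (C := C')
      (hwf_meas.comp (hXsm n)).aestronglyMeasurable ?_) _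
    filter_upwards [hdom] with ω hω
    rw [Function.comp_apply, hwf, Set.indicator_of_mem (hω n).1]
    exact hC' _ (hω n).1
  set R : ℕ → Ω → ℝ := fun n =>
    (fun ω => -γ n * gh n ω (Xs n ω - p)) + fun ω => (2 * K)⁻¹ * γ n ^ 2 * ‖gh n ω‖ ^ 2 with hR
  have hR1 : ∀ n, Integrable (fun ω => -γ n * gh n ω (Xs n ω - p)) μ := fun n =>
    (hpair n).const_mul _
  have hR2 : ∀ n, Integrable (fun ω => (2 * K)⁻¹ * γ n ^ 2 * ‖gh n ω‖ ^ 2) μ := fun n =>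
    (hghsq n).const_mul _
  have hRS := ae_tendsto_and_summable_of_condExp_le (μ := μ) (ℱ := ℱ)
    (D := fun n ω => Df (Xs n ω)) (v := fun n ω => γ n * wf (Xs n ω)) (R := R)
    (c := fun n => (2 * K)⁻¹ * γ n ^ 2 * G ^ 2)
    (fun n => (hDf_meas.comp (hXadapted n)).stronglyMeasurable) (fun n ω => hDf0 _)
    (fun n => ((hwf_meas.comp (hXadapted n)).const_mul (γ n)).stronglyMeasurable)
    (fun n ω => mul_nonneg (hγ_pos n).le (hwf0 _)) hwi
    (fun n => (hR1 n).add (hR2 n)) (fun n => by positivity)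
    ((hγ_sq.mul_left _).mul_right _) ?_ ?_
  · filter_upwards [hRS, hdom] with ω ⟨⟨d, hd⟩, hs⟩ hω
    simp only [hDf, hwf, Set.indicator_of_mem (hω _), Set.indicator_of_mem (hω _).1] at hd hs
    exact hh.tendsto_of_tendsto_bregman hXc hp hw hgp hγ_pos hγ_sum hω hd hs
  · intro n
    filter_upwards [hdom, hMD.step n] with ω hω hprox
    simp only [hDf, Set.indicator_of_mem (hω _)]
    have h1 := hprox.bregman_le hX hh (hω n) hp
    rw [norm_neg, norm_smul, mul_pow, Real.norm_eq_abs, sq_abs] at h1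
    refine h1.trans (le_of_eq ?_)
    simp only [hR, Pi.add_apply, neg_apply, smul_apply, smul_eq_mul]
    ring
  · intro n
    -- `Xs n - p` is known at time `n`, so it can be taken out of the conditional expectation of the
    -- dual pairing.
    have h1 : μ[fun ω => gh n ω (Xs n ω - p) | ℱ n] =ᵐ[μ]
        fun ω => (μ[gh n | ℱ n]) ω (Xs n ω - p) :=
      condExp_bilin_of_aestronglyMeasurable_left (ContinuousLinearMap.apply ℝ ℝ)
        (f := fun ω => Xs n ω - p)
        ((hXadapted n).stronglyMeasurable.sub stronglyMeasurable_const).aestronglyMeasurable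
        (hpair n) (hghi n)
    have h2 := condExp_add (hR1 n) (hR2 n) (ℱ n)
    have h3 := condExp_smul (μ := μ) (-γ n) (fun ω => gh n ω (Xs n ω - p)) (ℱ n)
    have h4 := condExp_smul (μ := μ) ((2 * K)⁻¹ * γ n ^ 2) (fun ω => ‖gh n ω‖ ^ 2) (ℱ n)
    filter_upwards [h1, h2, h3, h4, hOracle.unbiased n, hOracle.meanSquare n, hdom]
      with ω w1 w2 w3 w4 w5 w6 hω
    change (μ[gh n | ℱ n]) ω = _ at w5
    change (μ[fun ω' => ‖gh n ω'‖ ^ 2 | ℱ n]) ω ≤ _ at w6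
    have e3 : (μ[fun ω => -γ n * gh n ω (Xs n ω - p) | ℱ n]) ω
        = -γ n * g (Xs n ω) (Xs n ω - p) := by
      refine w3.trans ?_
      rw [Pi.smul_apply, smul_eq_mul, w1, w5]
    have e4 : (μ[fun ω => (2 * K)⁻¹ * γ n ^ 2 * ‖gh n ω‖ ^ 2 | ℱ n]) ω
        ≤ (2 * K)⁻¹ * γ n ^ 2 * G ^ 2 := by
      refine w4.le.trans ?_
      rw [Pi.smul_apply, smul_eq_mul]
      gcongr
    have e5 : wf (Xs n ω) = g (Xs n ω) (Xs n ω - p) := Set.indicator_of_mem (hω n).1 _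
    rw [hR, w2, Pi.add_apply, e3, e5]
    linarith

end MirrorDescentConvergence

/-- Gradient inequality for a function which is convex on a subset of the set along which its
derivative is taken. -/
theorem ConvexOn.apply_sub_le_of_hasFDerivWithinAt {V : Type*} [NormedAddCommGroup V]
    [NormedSpace ℝ V] {S T : Set V} {φ : V → ℝ} {L : StrongDual ℝ V} {x z : V}
    (hφ : ConvexOn ℝ T φ) (hTS : T ⊆ S) (hx : x ∈ T) (hz : z ∈ T)
    (hL : HasFDerivWithinAt φ L S x) : L (z - x) ≤ φ z - φ x := by
  -- Restriction to the segment from `x` to `z` reduces the claim to a convex function on `[0, 1]`,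
  -- whose derivative at `0` is at most its chord slope.
  have hmem : Set.MapsTo (AffineMap.lineMap x z) (Set.Icc (0 : ℝ) 1) T := fun t ht =>
    hφ.1.lineMap_mem hx hz ht
  have hconv : ConvexOn ℝ (Set.Icc (0 : ℝ) 1) (φ ∘ AffineMap.lineMap x z) :=
    (hφ.comp_affineMap (AffineMap.lineMap x z)).subset hmem (convex_Icc 0 1)
  have hderiv : HasDerivWithinAt (φ ∘ AffineMap.lineMap x z) (L (z - x)) (Set.Icc (0 : ℝ) 1) 0 := by
    have hL' : HasFDerivWithinAt φ L T (AffineMap.lineMap x z (0 : ℝ)) := by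
      simpa using hL.mono hTS
    exact hL'.comp_hasDerivWithinAt 0 AffineMap.hasDerivWithinAt_lineMap hmem
  have := hconv.le_slope_of_hasDerivWithinAt (by simp) (by simp) zero_lt_one hderiv
  simpa [slope_def_field] using this

/-! ### Saddle points and the monotone gradient field -/

section SaddlePoint

variable {E F : Type*} [NormedAddCommGroup E] [NormedSpace ℝ E]
  [NormedAddCommGroup F] [NormedSpace ℝ F] {X₁ : Set E} {X₂ : Set F} {f : E → F → ℝ}

theorem feasibleSet_eq_preimage :
    feasibleSet X₁ X₂ = WithLp.prodContinuousLinearEquiv 2 ℝ E F ⁻¹' (X₁ ×ˢ X₂) := rfl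

theorem isCompact_feasibleSet (h₁ : IsCompact X₁) (h₂ : IsCompact X₂) :
    IsCompact (feasibleSet X₁ X₂) := by
  rw [feasibleSet_eq_preimage]
  exact (WithLp.prodContinuousLinearEquiv 2 ℝ E F).toHomeomorph.isCompact_preimage.2 (h₁.prod h₂)

theorem convex_feasibleSet (h₁ : Convex ℝ X₁) (h₂ : Convex ℝ X₂) :
    Convex ℝ (feasibleSet X₁ X₂) := by
  rw [feasibleSet_eq_preimage]
  exact (h₁.prod h₂).linear_preimage
    (WithLp.prodContinuousLinearEquiv 2 ℝ E F).toLinearEquiv.toLinearMap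

/-- A saddle point of a strictly convex-concave function is strict. -/
theorem IsSaddle.gap_pos (hf : StrictlyConvexConcaveOn X₁ X₂ f) {xs x : WithLp 2 (E × F)}
    (hxs : IsSaddle X₁ X₂ f xs) (hx : x ∈ feasibleSet X₁ X₂) (hne : x ≠ xs) :
    f xs.fst x.snd < f x.fst xs.snd := by
  obtain ⟨⟨hs₁, hs₂⟩, hmax, hmin⟩ := hxs
  rcases ne_or_eq x.fst xs.fst with h₁ | h₁
  · have hlt : f xs.fst xs.snd < f x.fst xs.snd := by
      refine lt_of_le_of_ne (hmin _ hx.1) fun heq => h₁ ?_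
      refine (hf.1 _ hs₂).eq_of_isMinOn (fun y hy => ?_) (fun y hy => hmin y hy) hx.1 hs₁
      exact heq.symm.le.trans (hmin y hy)
    exact (hmax _ hx.2).trans_lt hlt
  · rcases ne_or_eq x.snd xs.snd with h₂ | h₂
    · have hlt : f xs.fst x.snd < f xs.fst xs.snd := by
        refine lt_of_le_of_ne (hmax _ hx.2) fun heq => h₂ ?_
        refine (hf.2 _ hs₁).eq_of_isMaxOn (fun y hy => ?_) (fun y hy => hmax y hy) hx.2 hs₂
        exact (hmax y hy).trans heq.symm.le
      exact hlt.trans_le (hmin _ hx.1)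
    · refine absurd ?_ hne
      exact (WithLp.prodContinuousLinearEquiv 2 ℝ E F).injective (Prod.ext h₁ h₂)

theorem IsSaddle.eq_of_isSaddle (hf : StrictlyConvexConcaveOn X₁ X₂ f) {xs y : WithLp 2 (E × F)}
    (hxs : IsSaddle X₁ X₂ f xs) (hy : IsSaddle X₁ X₂ f y) : y = xs := by
  by_contra hne
  have h1 := hxs.gap_pos hf hy.1 hne
  have h2 := hy.2.1 _ hxs.1.2
  have h3 := hy.2.2 _ hxs.1.1
  linarith

theorem exists_isSaddle (h₁c : IsCompact X₁) (h₁ : Convex ℝ X₁) (h₂c : IsCompact X₂)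
    (h₂ : Convex ℝ X₂) (hne : (feasibleSet X₁ X₂).Nonempty)
    (hcont : ContinuousOn (fun x : WithLp 2 (E × F) => f x.fst x.snd) (feasibleSet X₁ X₂))
    (hf : StrictlyConvexConcaveOn X₁ X₂ f) : ∃ x, IsSaddle X₁ X₂ f x := by
  obtain ⟨x₀, hx₀⟩ := hne
  have hcont₁ : ∀ y ∈ X₂, ContinuousOn (fun x => f x y) X₁ := fun y hy =>
    hcont.comp (f := fun x : E => WithLp.toLp 2 (x, y))
      ((WithLp.prod_continuous_toLp 2 E F).comp (by fun_prop)).continuousOn fun x hx => ⟨hx, hy⟩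
  have hcont₂ : ∀ x ∈ X₁, ContinuousOn (fun y => f x y) X₂ := fun x hx =>
    hcont.comp (f := fun y : F => WithLp.toLp 2 (x, y))
      ((WithLp.prod_continuous_toLp 2 E F).comp (by fun_prop)).continuousOn fun y hy => ⟨hx, hy⟩
  obtain ⟨a, ha, b, hb, hab⟩ := Sion.exists_isSaddlePointOn (f := f) ⟨_, hx₀.1⟩ h₁ h₁c
    (fun y hy => (hcont₁ y hy).lowerSemicontinuousOn)
    (fun y hy => (hf.1 y hy).convexOn.quasiconvexOn) h₂ ⟨_, hx₀.2⟩ h₂c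
    (fun x hx => (hcont₂ x hx).upperSemicontinuousOn)
    (fun x hx => (hf.2 x hx).concaveOn.quasiconcaveOn)
  exact ⟨WithLp.toLp 2 (a, b), ⟨ha, hb⟩, fun y hy => hab a ha y hy, fun y hy => hab y hy b hb⟩

/-- Add two gradient inequalities at `x`: one for `f(·, x₂)` towards `z₁`, one for `-f(x₁, ·)`
towards `z₂`. The terms `f(x₁, x₂)` cancel, and the sign in the second block of the field matches
the concave player. -/
theorem HasC1GradientOn.gap_le_gradientField
    {D₁ : WithLp 2 (E × F) → StrongDual ℝ E} {D₂ : WithLp 2 (E × F) → StrongDual ℝ F}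
    (hD : HasC1GradientOn X₁ X₂ f D₁ D₂) (hf : StrictlyConvexConcaveOn X₁ X₂ f)
    {x z : WithLp 2 (E × F)} (hx : x ∈ feasibleSet X₁ X₂) (hz : z ∈ feasibleSet X₁ X₂) :
    f x.fst z.snd - f z.fst x.snd ≤ gradientField D₁ D₂ x (x - z) := by
  have hder := hD.hasFDerivWithinAt x hx
  -- Joint convexity fails, so convexity is used on the slice through `x`, while the derivative is
  -- relative to the whole feasible set.
  have hconv₁ : ConvexOn ℝ {q : WithLp 2 (E × F) | q.fst ∈ X₁ ∧ q.snd = x.snd}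
      (fun q => f q.fst q.snd) := by
    have h := (hf.1 _ hx.2).convexOn
    have hsnd : ∀ {s t : ℝ}, s + t = 1 → s • x.snd + t • x.snd = x.snd := fun hst => by
      rw [← add_smul, hst, one_smul]
    refine ⟨?_, ?_⟩
    · rintro a ⟨ha, ha'⟩ b ⟨hb, hb'⟩ s t hs ht hst
      exact ⟨h.1 ha hb hs ht hst, by simp [ha', hb', hsnd hst]⟩
    · rintro a ⟨ha, ha'⟩ b ⟨hb, hb'⟩ s t hs ht hst
      simpa [ha', hb', hsnd hst] using h.2 ha hb hs ht hst
  have hconv₂ : ConvexOn ℝ {q : WithLp 2 (E × F) | q.fst = x.fst ∧ q.snd ∈ X₂}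
      (fun q => -f q.fst q.snd) := by
    have h := (hf.2 _ hx.1).concaveOn.neg
    have hfst : ∀ {s t : ℝ}, s + t = 1 → s • x.fst + t • x.fst = x.fst := fun hst => by
      rw [← add_smul, hst, one_smul]
    refine ⟨?_, ?_⟩
    · rintro a ⟨ha, ha'⟩ b ⟨hb, hb'⟩ s t hs ht hst
      exact ⟨by simp [ha, hb, hfst hst], h.1 ha' hb' hs ht hst⟩
    · rintro a ⟨ha, ha'⟩ b ⟨hb, hb'⟩ s t hs ht hst
      simpa [ha, hb, hfst hst] using h.2 ha' hb' hs ht hst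
  have i₁ := hconv₁.apply_sub_le_of_hasFDerivWithinAt (S := feasibleSet X₁ X₂)
    (z := WithLp.toLp 2 (z.fst, x.snd)) (fun q hq => ⟨hq.1, hq.2 ▸ hx.2⟩) ⟨hx.1, rfl⟩
    ⟨hz.1, rfl⟩ hder
  have i₂ := hconv₂.apply_sub_le_of_hasFDerivWithinAt (S := feasibleSet X₁ X₂)
    (z := WithLp.toLp 2 (x.fst, z.snd)) (fun q hq => ⟨hq.1 ▸ hx.1, hq.2⟩) ⟨rfl, hx.2⟩
    ⟨rfl, hz.2⟩ hder.neg
  simp only [neg_apply, add_apply, ContinuousLinearMap.comp_apply, WithLp.fstL_apply,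
    WithLp.sndL_apply, WithLp.toLp_fst, WithLp.toLp_snd, map_sub] at i₁ i₂
  simp only [gradientField, sub_apply, ContinuousLinearMap.comp_apply, WithLp.fstL_apply,
    WithLp.sndL_apply, map_sub]
  linarith

theorem HasC1GradientOn.continuousOn_gradientField
    {D₁ : WithLp 2 (E × F) → StrongDual ℝ E} {D₂ : WithLp 2 (E × F) → StrongDual ℝ F}
    (hD : HasC1GradientOn X₁ X₂ f D₁ D₂) :
    ContinuousOn (gradientField D₁ D₂) (feasibleSet X₁ X₂) :=
  (hD.continuousOn_fst.clm_comp continuousOn_const).sub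
    (hD.continuousOn_snd.clm_comp continuousOn_const)

end SaddlePoint

theorem mainTheorem6
    {E F : Type*} [NormedAddCommGroup E] [NormedSpace ℝ E] [FiniteDimensional ℝ E]
    [NormedAddCommGroup F] [NormedSpace ℝ F] [FiniteDimensional ℝ F]
    {Ω : Type*} [MeasurableSpace Ω] (μ : Measure Ω) [IsProbabilityMeasure μ]
    -- the saddle-point problem
    (X₁ : Set E) (X₂ : Set F)
    (hX₁_compact : IsCompact X₁) (hX₁_convex : Convex ℝ X₁)
    (hX₂_compact : IsCompact X₂) (hX₂_convex : Convex ℝ X₂)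
    (f : E → F → ℝ)
    (D₁ : WithLp 2 (E × F) → StrongDual ℝ E) (D₂ : WithLp 2 (E × F) → StrongDual ℝ F)
    (hf_C1 : HasC1GradientOn X₁ X₂ f D₁ D₂)
    (hf_strict : StrictlyConvexConcaveOn X₁ X₂ f)
    -- the distance-generating function
    (K : ℝ) (h : WithLp 2 (E × F) → ℝ) (dh : WithLp 2 (E × F) → StrongDual ℝ (WithLp 2 (E × F)))
    (hh : IsDGF (feasibleSet X₁ X₂) K h dh)
    -- the step-sizes
    (γ : ℕ → ℝ) (hγ_pos : ∀ n, 0 < γ n)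
    (hγ_sum : Tendsto (fun n => ∑ k ∈ Finset.range n, γ k) atTop atTop)
    (hγ_sq : Summable (fun n => γ n ^ 2))
    -- the algorithm and its gradient oracle
    (G : ℝ) (gh : ℕ → Ω → StrongDual ℝ (WithLp 2 (E × F))) (Xs : ℕ → Ω → WithLp 2 (E × F))
    (hMD : IsMirrorDescent μ (feasibleSet X₁ X₂) h dh γ gh Xs)
    (hOracle : IsStochasticOracle μ (gradientField D₁ D₂) G gh Xs) :
    ∃ xstar : WithLp 2 (E × F),
      IsSaddle X₁ X₂ f xstar ∧ (∀ y, IsSaddle X₁ X₂ f y → y = xstar) ∧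
        ∀ᵐ ω ∂μ, Tendsto (fun n => Xs n ω) atTop (𝓝 xstar) := by
  -- Nonemptiness comes from the initial point: an almost sure event of a probability measure is
  -- nonempty.
  have hne : (feasibleSet X₁ X₂).Nonempty := by
    obtain ⟨ω, hω⟩ := hMD.init.exists
    exact ⟨_, hω.1⟩
  obtain ⟨xs, hxs⟩ := exists_isSaddle hX₁_compact hX₁_convex hX₂_compact hX₂_convex hne
    (fun x hx => (hf_C1.hasFDerivWithinAt x hx).continuousWithinAt) hf_strict
  refine ⟨xs, hxs, fun y hy => hxs.eq_of_isSaddle hf_strict hy, ?_⟩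
  refine hMD.ae_tendsto (isCompact_feasibleSet hX₁_compact hX₂_compact)
    (convex_feasibleSet hX₁_convex hX₂_convex) hh hγ_pos hγ_sum hγ_sq
    hf_C1.continuousOn_gradientField hxs.1 (fun x hx hne => ?_) hOracle
  have h1 := hxs.gap_pos hf_strict hx hne
  have h2 := hf_C1.gap_le_gradientField hf_strict hx hxs.1
  linarith
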